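/- Consider the adjoint computation for $m\ge 1$ time steps $u_0\to u_1\to\dots\to u_m$ of a multistage time-stepping scheme. Working memory holds one solution $u_n$, initially $u_0$, and, if $u_n$ was just computed or restored, also the stage values of the step $n-1\to n$. A checkpoint is composed of a solution $u_n$ ($n\ge 1$) and the stage values of the step $n-1\to n$; at most $s\ge 1$ checkpoints may be held at any time, and the initial solution is not kept anywhere else. A schedule is a finite sequence of the following actions: carry out one forward step $n\to n+1$ ($n<m$) from the current solution; store the current solution and stage values in a checkpoint; restore a checkpoint into working memory (keeping the checkpoint); delete a checkpoint; carry out the backward step $n\to n-1$. The backward steps $m\to m-1,\ m-1\to m-2,\ \dots,\ 1\to 0$ must all be carried out, in this order, and the backward step $n\to n-1$ is possible only while $u_n$ and the stage values of the step $n-1\to n$ are in working memory. A recomputation is the execution of a forward step that has been executed before. Then there is a unique integer $t$ with $$\binom{s+t-1}{t-1} < m \le \binom{s+t}{t},$$ and the minimal number of recomputations among all such schedules is attained and equal to $$\tilde p(m,s) = (t-1)\,m-\binom{s+t}{t-1}+1.$$ Here binomial coefficients with negative lower index are $0$ (so $t=0$ if $m=1$). -/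

import Mathlib

namespace Checkpointing

/-- The actions of which a checkpointing schedule consists. -/
inductive Action where
  /-- carry out one forward time step from the current solution -/
  | advance : Action
  /-- save the current solution together with the stage values of the step that produced it -/
  | store : Action
  /-- load the checkpoint at index `i` back into working memory (it is not removed) -/
  | restore (i : ℕ) : Action
  /-- delete the checkpoint at index `i` -/
  | discard (i : ℕ) : Action
  /-- carry out one backward (adjoint) step -/
  | reverse : Action

/-- The state of an adjoint computation. Solutions `u_0, u_1, …` are referred to by their index. -/
structure State where
  /-- index `n` of the solution `u_n` in working memory -/
  sol : ℕ
  /-- whether the stage values of the time step `sol - 1 → sol` are in working memory as well -/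
  hasStages : Bool
  /-- the checkpoints held: `i` stands for the solution `u_i` together with the stage values of
  the time step `i - 1 → i` -/
  ckpts : Finset ℕ
  /-- index of the current adjoint variable: the time steps beyond `adj` have been reversed -/
  adj : ℕ
  /-- the time steps carried out at least once so far are `0 → 1, …, furthest - 1 → furthest` -/
  furthest : ℕ

/-- At the start only the initial solution `u_0` is in working memory (there are no stage values),
nothing is checkpointed, and all of the `m` time steps are to be reversed. -/
def State.initial (m : ℕ) : State where
  sol := 0
  hasStages := false
  ckpts := ∅
  adj := m
  furthest := 0

/-- Whether an action may be taken, for `m` time steps and at most `s` checkpoints held. A backward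
step `n → n - 1` needs the stage values of the time step `n - 1 → n` in working memory. -/
def State.Enabled (m s : ℕ) (S : State) : Action → Prop
  | .advance => S.sol < m
  | .store => S.hasStages = true ∧ (insert S.sol S.ckpts).card ≤ s
  | .restore i => i ∈ S.ckpts
  | .discard i => i ∈ S.ckpts
  | .reverse => S.hasStages = true ∧ S.sol = S.adj

/-- The effect of an action. -/
def State.next (S : State) : Action → State
  | .advance =>
      { S with sol := S.sol + 1, hasStages := true, furthest := max S.furthest (S.sol + 1) }
  | .store => { S with ckpts := insert S.sol S.ckpts }
  | .restore i => { S with sol := i, hasStages := true }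
  | .discard i => { S with ckpts := S.ckpts.erase i }
  | .reverse => { S with adj := S.adj - 1 }

/-- An action is a recomputation if it carries out a time step that was carried out before. -/
def State.cost (S : State) : Action → ℕ
  | .advance => if S.sol < S.furthest then 1 else 0
  | _ => 0

/-- The schedule `σ`, started in `S`, takes only permitted actions and reverses all time steps. -/
def CompletesFrom (m s : ℕ) : State → List Action → Prop
  | S, [] => S.adj = 0
  | S, a :: σ => S.Enabled m s a ∧ CompletesFrom m s (S.next a) σ

/-- The number of recomputations in the schedule `σ` started in `S`. -/
def recomputationsFrom : State → List Action → ℕ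
  | _, [] => 0
  | S, a :: σ => S.cost a + recomputationsFrom (S.next a) σ

/-- `σ` is a schedule for the adjoint computation of `m` time steps with at most `s` checkpoints,
each composed of the solution and the stage values at a time step. -/
def IsSchedule (m s : ℕ) (σ : List Action) : Prop :=
  CompletesFrom m s (State.initial m) σ

/-- The number of recomputations in a schedule for `m` time steps. -/
def recomputations (m : ℕ) (σ : List Action) : ℕ :=
  recomputationsFrom (State.initial m) σ

/-- The binomial coefficient with integer arguments, zero if the lower one is negative. -/
noncomputable def binom (n k : ℤ) : ℤ :=
  if 0 ≤ k then Ring.choose n k.toNat else 0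

/-- `binom (s + t - 1) (t - 1) < m ≤ binom (s + t) t`. -/
def IsRepetitionNumber (m s : ℕ) (t : ℤ) : Prop :=
  binom (s + t - 1) (t - 1) < m ∧ (m : ℤ) ≤ binom (s + t) t

end Checkpointing

/-!
Every time step is executed for the first time once, so a schedule with `N` forward steps has at
least `N - m` recomputations; the question is how many forward steps are needed. Write
`L_t(m, s) = t * m - C(s + t, t - 1)`. Consecutive values differ by `m - C(s + t, t)`, so the
repetition number is where `t ↦ L_t(m, s)` is largest, and the theorem says that
`1 + max_t L_t(m, s)` forward steps are necessary and sufficient.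

*Lower bound.* The maximum `F(m, s)` of `0` and of `L_t(m, s)` over `t ≤ T` (`stepBound`) satisfies
`F(m, s) ≤ k + F(k, s) + F(m - k, s - 1)` by Pascal's rule (`stepBound_le_split`). Call the
indices `x` for which `u_x` and its stage values are at hand (checkpoints and working memory)
available. A plan moves some of them forward, `x₁ ↦ q₁, x₂ ↦ q₂, …`, with
`1 < x₁ ≤ q₁ < x₂ ≤ q₂ < …`, pays `∑ (qᵢ - xᵢ)` for that, and pays `F` for each gap between
consecutive elements of `1, q₁, q₂, …, adj + 1`, where each gap has one checkpoint less at its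
disposal than the one before. The cheapest plan is a potential: going backwards through a schedule,
an advance raises it by at most one and no other action raises it
(`CompletesFrom.isPlan`). The interleaving `qᵢ < xᵢ₊₁` is what makes this work: an advance then
lengthens at most one move, and a move that would break the interleaving can be dropped
(`IsPlan.drop`). The limit on the number of checkpoints enters for the backward step only
(`IsPlan.extend`): the available index `adj` has to join the plan as a new element, and since each
element of the plan uses up an available index of its own, there is room for it.

*Upper bound.* From `u_d` in working memory, store `d`, advance by `k` steps, deal recursively with
what lies beyond `d + k` with one checkpoint less, reverse the step that leads to `u_{d + k}`, and
deal recursively with the remaining `k - 1` steps after `u_d`. By Pascal's rule `k` can be chosen so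
that both parts have sizes for which the closed formula is available (`exists_schedule_segment`).
-/

namespace Checkpointing

/-! ### The lower bound function -/

/-- The largest of `0` and of the numbers `t * m - C(s + t, t - 1)` for `t ≤ T`. The subtraction is
truncated; the term for `t = 0` is `0`. -/
def stepBound (T m s : ℕ) : ℕ :=
  (Finset.range (T + 1)).sup fun t => t * m - (s + t).choose (t - 1)

theorem le_stepBound {T t : ℕ} (ht : t ≤ T) (m s : ℕ) :
    t * m - (s + t).choose (t - 1) ≤ stepBound T m s :=
  Finset.le_sup (f := fun t => t * m - (s + t).choose (t - 1))
    (Finset.mem_range.2 (Nat.lt_succ_of_le ht))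

theorem stepBound_one (T s : ℕ) : stepBound T 1 s = 0 := by
  refine Nat.le_zero.1 (Finset.sup_le fun t _ => ?_)
  rcases t with _ | t
  · simp
  · have h : (t + 1).choose t ≤ (s + (t + 1)).choose t := Nat.choose_le_choose t (by omega)
    rw [Nat.choose_succ_self_right] at h
    simp only [Nat.add_sub_cancel]
    omega

theorem stepBound_anti (T m s : ℕ) : stepBound T m (s + 1) ≤ stepBound T m s := by
  refine Finset.sup_le fun t ht => le_trans ?_
    (le_stepBound (Nat.le_of_lt_succ (Finset.mem_range.1 ht)) m s)
  exact Nat.sub_le_sub_left (Nat.choose_le_choose _ (by omega)) _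

/-- Pascal's rule splits the `t`-th term for `k + l` steps into `k`, the `(t - 1)`-st term for `k`
steps and the `t`-th term for `l` steps with one checkpoint less. -/
theorem stepBound_le_split (T k l s : ℕ) :
    stepBound T (k + l) (s + 1) ≤ k + stepBound T k (s + 1) + stepBound T l s := by
  refine Finset.sup_le fun t ht => ?_
  have ht : t ≤ T := Nat.le_of_lt_succ (Finset.mem_range.1 ht)
  rcases t with _ | t
  · simp
  have h1 := le_stepBound (T := T) (t := t) (by omega) k (s + 1)
  have h2 := le_stepBound ht l s
  have h3 : (t + 1) * (k + l) = t * k + k + (t + 1) * l := by ring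
  simp only [Nat.add_sub_cancel] at h2 ⊢
  rcases t with _ | t
  · simp at h2 ⊢
    omega
  · have h4 : (s + 1 + (t + 1 + 1)).choose (t + 1)
        = (s + 1 + (t + 1)).choose t + (s + (t + 1 + 1)).choose (t + 1) := by
      rw [show s + 1 + (t + 1 + 1) = s + 1 + (t + 1) + 1 by ring, Nat.choose_succ_succ,
        show s + (t + 1 + 1) = s + 1 + (t + 1) by ring]
    simp only [Nat.add_sub_cancel] at h1
    rw [h3, h4]
    omega

/-! ### Plans -/

/-- `IsPlan T X a d s N` says that some plan for the steps beyond `d` up to `a` costs at most `N`,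
where `X` is the set of available indices, `d` the last element of the plan so far, and `s` the
number of elements that may still be added. Each of these is a move `x ↦ q` with `x ∈ X`. The gap
that follows `d` has `s` checkpoints at its disposal, one of which is for `d` itself. -/
inductive IsPlan (T : ℕ) (X : Finset ℕ) (a : ℕ) : ℕ → ℕ → ℕ → Prop
  | last {d s N : ℕ} : d ≤ a → stepBound T (a + 1 - d) s ≤ N → IsPlan T X a d s N
  | move {d s N : ℕ} (x q c : ℕ) : x ∈ X → d < x → x ≤ q → IsPlan T X a q s c →
      stepBound T (q - d) (s + 1) + (q - x) + c ≤ N → IsPlan T X a d (s + 1) N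

namespace IsPlan

variable {T : ℕ} {X Y : Finset ℕ} {a d s N : ℕ}

theorem mono (h : IsPlan T X a d s N) (hXY : ∀ x ∈ X, d < x → x ∈ Y) : IsPlan T Y a d s N := by
  induction h with
  | last h1 h2 => exact .last h1 h2
  | move x q c hx h1 h2 _ h3 ih =>
    exact .move x q c (hXY x hx h1) h1 h2 (ih fun y hy hq => hXY y hy (by omega)) h3

theorem mono_cost {M : ℕ} (h : IsPlan T X a d s N) (hNM : N ≤ M) : IsPlan T X a d s M := by
  cases h with
  | last h1 h2 => exact .last h1 (h2.trans hNM)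
  | move x q c hx h1 h2 h3 h4 => exact .move x q c hx h1 h2 h3 (h4.trans hNM)

theorem succ_slots (h : IsPlan T X a d s N) : IsPlan T X a d (s + 1) N := by
  induction h with
  | last h1 h2 => exact .last h1 ((stepBound_anti _ _ _).trans h2)
  | @move d s N x q c hx h1 h2 _ h3 ih =>
    refine .move x q c hx h1 h2 ih (le_trans ?_ h3)
    have := stepBound_anti T (q - d) (s + 1)
    omega

/-- An element `q` of a plan can be removed at the price of the distance to the element before. -/
theorem drop {q c : ℕ} (hdq : d < q) (h : IsPlan T X a q s c) :
    IsPlan T X a d (s + 1) (stepBound T (q - d) (s + 1) + (q - d) + c) := by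
  cases h with
  | last h1 h2 =>
    refine .last (by omega) ?_
    have := stepBound_le_split T (q - d) (a + 1 - q) s
    rw [show q - d + (a + 1 - q) = a + 1 - d by omega] at this
    omega
  | @move _ s _ x' q' c' hx h1 h2 h3 h4 =>
    refine .move x' q' c' hx (by omega) h2 h3.succ_slots ?_
    have := stepBound_le_split T (q - d) (q' - q) (s + 1)
    rw [show q - d + (q' - q) = q' - d by omega] at this
    omega

/-- Undoing an advance: if `p` takes the place of `p + 1` among the available indices, plans become
more expensive by at most one. -/
theorem retreat {p : ℕ} (h : IsPlan T X a d s N) (hX : ∀ x ∈ X, x ≠ p + 1 → x ∈ Y)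
    (hp : p ∈ Y) : IsPlan T Y a d s (N + 1) := by
  induction h with
  | last h1 h2 => exact .last h1 (by omega)
  | @move d s N x q c hx h1 h2 h3 h4 ih =>
    by_cases hxp : x = p + 1
    · have h3' : IsPlan T Y a q s c := h3.mono fun y hy hq => hX y hy (by omega)
      rcases (show d < p ∨ d = p by omega) with hd | rfl
      · exact .move p q c hp hd (by omega) h3' (by omega)
      -- The move `p ↦ q` would start from `d`, so the interleaving fails and `q` is removed.
      · exact (drop (by omega) h3').mono_cost (by omega)
    · exact .move x q (c + 1) (hX x hx hxp) h1 h2 ih (by omega)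

/-- If `a + 1` is available, a plan up to `a` yields one up to `a + 1` of the same cost, with
`a + 1` as its new last element. There is room for it because the earlier elements have used up
distinct available indices. -/
theorem extend (h : IsPlan T X a d s N) (ha : a + 1 ∈ X)
    (hcard : (X.filter (d < ·)).card ≤ s) : IsPlan T X (a + 1) d s N := by
  induction h with
  | @last d s N h1 h2 =>
    have hpos : 0 < (X.filter (d < ·)).card :=
      Finset.card_pos.2 ⟨a + 1, by simp [ha]; omega⟩
    obtain ⟨s, rfl⟩ : ∃ r, s = r + 1 := ⟨s - 1, by omega⟩
    refine .move (a + 1) (a + 1) 0 ha (by omega) le_rfl (.last le_rfl ?_) (by omega)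
    rw [show a + 1 + 1 - (a + 1) = 1 by omega, stepBound_one]
  | @move d s N x q c hx h1 h2 h3 h4 ih =>
    refine .move x q c hx h1 h2 (ih ?_) h4
    have hlt : (X.filter (q < ·)).card < (X.filter (d < ·)).card := by
      refine Finset.card_lt_card (Finset.ssubset_iff_of_subset ?_ |>.2 ⟨x, ?_, ?_⟩)
      · intro y hy
        simp only [Finset.mem_filter] at hy ⊢
        exact ⟨hy.1, by omega⟩
      · simp [hx, h1]
      · simp; omega
    omega

end IsPlan

/-! ### The lower bound for schedules -/

/-- The number of forward steps in a schedule. -/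
def advances : List Action → ℕ
  | [] => 0
  | .advance :: σ => advances σ + 1
  | _ :: σ => advances σ

theorem advances_le_recomputationsFrom {m s : ℕ} (σ : List Action) (S : State)
    (h : CompletesFrom m s S σ) (hS : S.furthest ≤ m) :
    S.furthest + advances σ ≤ recomputationsFrom S σ + m := by
  induction σ generalizing S with
  | nil => simpa [advances, recomputationsFrom] using hS
  | cons b σ ih =>
    obtain ⟨hb, h⟩ := h
    have ih := ih _ h
    cases b with
    | advance =>
      simp only [State.Enabled] at hb
      simp only [State.next] at ih
      simp only [advances, recomputationsFrom, State.cost, State.next]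
      have := ih (by omega)
      split_ifs <;> omega
    | _ =>
      simp only [State.next] at ih
      simp only [advances, recomputationsFrom, State.cost, State.next]
      have := ih hS
      omega

/-- As long as steps are left to be reversed, `u_1` is available and some plan costs at most the
number of forward steps still to come: nothing but the initial solution leads to `u_1`. -/
theorem CompletesFrom.isPlan {m s : ℕ} (T : ℕ) (σ : List Action) (S : State)
    (h : CompletesFrom m s S σ) (hst : S.hasStages = true) (hsol : 1 ≤ S.sol)
    (hck : ∀ c ∈ S.ckpts, 1 ≤ c) (hcard : S.ckpts.card ≤ s) :
    S.adj = 0 ∨ 1 ∈ insert S.sol S.ckpts ∧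
      IsPlan T (insert S.sol S.ckpts) S.adj 1 s (advances σ) := by
  induction σ generalizing S with
  | nil => exact Or.inl h
  | cons b σ ih =>
    obtain ⟨hb, h⟩ := h
    have ih := ih _ h
    cases b with
    | advance =>
      rcases ih rfl (by simp [State.next]) hck hcard with h0 | ⟨h1, h2⟩
      · exact Or.inl h0
      · simp only [State.next] at h1 h2
        refine Or.inr ⟨?_, h2.retreat (p := S.sol) ?_ (by simp)⟩
        · simp only [Finset.mem_insert] at h1 ⊢
          exact h1.imp (by omega) id
        · simp only [Finset.mem_insert]
          tauto
    | store =>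
      have := ih hst hsol (by simpa [State.next, hsol] using hck) hb.2
      simpa [State.next, advances] using this
    | restore i =>
      have hi : i ∈ S.ckpts := hb
      rcases ih rfl (hck i hi) hck hcard with h0 | ⟨h1, h2⟩
      · exact Or.inl h0
      · have hsub : ∀ x ∈ insert i S.ckpts, x ∈ insert S.sol S.ckpts := by
          intro x hx
          rw [Finset.insert_eq_of_mem hi] at hx
          exact Finset.mem_insert_of_mem hx
        exact Or.inr ⟨hsub 1 h1, h2.mono fun x hx _ => hsub x hx⟩
    | discard i =>
      rcases ih hst hsol (fun c hc => hck c (Finset.mem_of_mem_erase hc))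
        ((Finset.card_erase_le).trans hcard) with h0 | ⟨h1, h2⟩
      · exact Or.inl h0
      · have hsub : ∀ x ∈ insert S.sol (S.ckpts.erase i), x ∈ insert S.sol S.ckpts :=
          Finset.insert_subset_insert _ (Finset.erase_subset _ _)
        exact Or.inr ⟨hsub 1 h1, h2.mono fun x hx _ => hsub x hx⟩
    | reverse =>
      have hsa : S.sol = S.adj := hb.2
      rcases ih hst hsol hck hcard with h0 | ⟨h1, h2⟩
      · have h0 : S.adj - 1 = 0 := h0
        have h1 : S.adj = 1 := by omega
        refine Or.inr ⟨by simp [hsa, h1], .last h1.ge ?_⟩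
        rw [h1, stepBound_one]
        exact Nat.zero_le _
      · simp only [State.next] at h1 h2
        refine Or.inr ⟨h1, ?_⟩
        have ha : S.adj - 1 + 1 = S.adj := by omega
        rw [← ha]
        refine h2.extend (by simp [ha, hsa]) ?_
        have hlt : ((insert S.sol S.ckpts).filter (1 < ·)).card < (insert S.sol S.ckpts).card :=
          Finset.card_lt_card
            (Finset.filter_ssubset.2 ⟨1, h1, lt_irrefl 1⟩)
        have := Finset.card_insert_le S.sol S.ckpts
        omega

/-- The first action has to be an advance, after which only `u_1` is available. -/
theorem stepBound_le_recomputations {m s : ℕ} (hm : 1 ≤ m) {σ : List Action}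
    (h : IsSchedule m s σ) (T : ℕ) : stepBound T m s + 1 ≤ recomputations m σ + m := by
  have hadv := advances_le_recomputationsFrom σ _ h (Nat.zero_le m)
  change 0 + advances σ ≤ recomputations m σ + m at hadv
  refine le_trans ?_ ((Nat.zero_add _).symm.le.trans hadv)
  cases σ with
  | nil =>
    have : m = 0 := h
    omega
  | cons b σ =>
    obtain ⟨hb, h⟩ := h
    cases b with
    | advance =>
      rcases h.isPlan T σ _ rfl le_rfl (by simp [State.next, State.initial])
        (by simp [State.next, State.initial]) with h0 | ⟨-, h2⟩
      · have : m = 0 := h0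
        omega
      · simp only [State.next, State.initial] at h2
        cases h2 with
        | last h3 h4 => simpa [advances] using h4
        | move x q c hx h3 _ _ _ =>
          simp only [Finset.mem_insert, Finset.notMem_empty, or_false] at hx
          omega
    | store => simp [State.Enabled, State.initial] at hb
    | restore i => simp [State.Enabled, State.initial] at hb
    | discard i => simp [State.Enabled, State.initial] at hb
    | reverse => simp [State.Enabled, State.initial] at hb

/-! ### Optimal schedules -/

/-- Advancing `k` times. Here and below, a schedule `σ` that starts from the state to be reached is
extended to a schedule `τ` from the given state, and the added forward steps are counted as added
recomputations plus the growth of `furthest`. -/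
theorem exists_schedule_advance {m s : ℕ} (k d : ℕ) (b : Bool) (C : Finset ℕ) (a f : ℕ)
    (σ : List Action) (hk : 1 ≤ k) (hm : d + k ≤ m) (hf : d ≤ f)
    (h : CompletesFrom m s ⟨d + k, true, C, a, max f (d + k)⟩ σ) :
    ∃ τ, CompletesFrom m s ⟨d, b, C, a, f⟩ τ ∧
      recomputationsFrom ⟨d, b, C, a, f⟩ τ + max f (d + k) =
        recomputationsFrom ⟨d + k, true, C, a, max f (d + k)⟩ σ + f + k := by
  induction k generalizing d b f with
  | zero => omega
  | succ k ih =>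
    rcases Nat.eq_zero_or_pos k with rfl | hk0
    · rw [Nat.zero_add] at h ⊢
      refine ⟨.advance :: σ, ⟨(by simp [State.Enabled]; omega), by simpa [State.next] using h⟩, ?_⟩
      simp only [recomputationsFrom, State.cost, State.next]
      split_ifs <;> omega
    · have he : max (max f (d + 1)) (d + 1 + k) = max f (d + (k + 1)) := by omega
      have he' : d + 1 + k = d + (k + 1) := by omega
      obtain ⟨τ, h1, h2⟩ := ih (d + 1) true (max f (d + 1)) hk0 (by omega) (by omega)
        (by rw [he, he']; exact h)
      rw [he, he'] at h2
      refine ⟨.advance :: τ, ⟨(by simp [State.Enabled]; omega), h1⟩, ?_⟩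
      simp only [recomputationsFrom, State.cost, State.next]
      split_ifs <;> omega

theorem choose_succ_le_mul_choose (s u : ℕ) :
    (s + u + 1).choose u ≤ (u + 1) * (s + u).choose u := by
  rcases u with _ | u
  · simp
  · have h := Nat.choose_succ_right_eq (s + (u + 1)) u
    rw [show s + (u + 1) - u = s + 1 by omega] at h
    have h1 : (s + (u + 1)).choose u * 1 ≤ (s + (u + 1)).choose u * (s + 1) :=
      Nat.mul_le_mul_left _ (by omega)
    rw [Nat.choose_succ_succ]
    linarith

/-- With `u_d` in working memory and `s` unused checkpoints, the `n - 1` steps after `u_d` can be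
reversed with `A` forward steps, where `A = t * n - C(s + t, t - 1)` for `t = u + 1`, in such a way
that `u_d` is in working memory and the checkpoints are as before at the end. The range for `n`
includes both ends, where the formulas for consecutive `t` agree. -/
theorem exists_schedule_segment {m c : ℕ} (n s u d A : ℕ) (C : Finset ℕ) (f : ℕ) (σ : List Action)
    (hlo : (s + u).choose u ≤ n) (hhi : n ≤ (s + u + 1).choose (u + 1))
    (hA : A + (s + u + 1).choose u = (u + 1) * n)
    (hC : ∀ i ∈ C, i < d) (hcard : C.card + s ≤ c) (hm : d + n ≤ m + 1) (hf : d ≤ f)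
    (h : CompletesFrom m c ⟨d, true, C, d, max f (d + n - 1)⟩ σ) :
    ∃ τ, CompletesFrom m c ⟨d, true, C, d + n - 1, f⟩ τ ∧
      recomputationsFrom ⟨d, true, C, d + n - 1, f⟩ τ + max f (d + n - 1) =
        recomputationsFrom ⟨d, true, C, d, max f (d + n - 1)⟩ σ + f + A := by
  induction n using Nat.strong_induction_on generalizing s u d A C f σ with
  | _ n ih =>
    have hn : 1 ≤ n := le_trans (Nat.choose_pos (by omega)) hlo
    rcases (show n = 1 ∨ 2 ≤ n by omega) with rfl | hn2
    · -- No forward step is needed: `A = 0` by `u + 1 ≤ C(s + u + 1, u)`.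
      have hA0 : A = 0 := by
        have h1 : (u + 1).choose u ≤ (s + u + 1).choose u := Nat.choose_le_choose u (by omega)
        rw [Nat.choose_succ_self_right] at h1
        omega
      have he : max f (d + 1 - 1) = f := by omega
      rw [he] at h ⊢
      rw [Nat.add_sub_cancel]
      exact ⟨σ, h, by omega⟩
    · -- Without a free checkpoint the range for `n` is reduced to `n = 1`.
      obtain ⟨s, rfl⟩ : ∃ r, s = r + 1 := by
        rcases s with _ | s
        · simp at hhi
          omega
        · exact ⟨s, rfl⟩
      -- The choice of `k`, and the numbers of forward steps beyond `d + k` and before it.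
      obtain ⟨k, v, A₁, A₂, hk1, hkn, hlo1, hhi1, hA1, hlo2, hhi2, hA2, hsum⟩ :
          ∃ k v A₁ A₂, 1 ≤ k ∧ k < n ∧ (s + u).choose u ≤ n - k ∧
            n - k ≤ (s + u + 1).choose (u + 1) ∧
            A₁ + (s + u + 1).choose u = (u + 1) * (n - k) ∧
            (s + 1 + v).choose v ≤ k ∧ k ≤ (s + 1 + v + 1).choose (v + 1) ∧
            A₂ + (s + 1 + v + 1).choose v = (v + 1) * k ∧ A = k + A₁ + A₂ := by
        rcases u with _ | u
        · simp only [Nat.add_zero, Nat.zero_add, Nat.choose_zero_right, Nat.choose_one_right,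
            Nat.one_mul] at hlo hhi hA
          exact ⟨1, 0, n - 1 - 1, 0, le_rfl, by omega, by simp; omega, by simp; omega,
            by simp; omega, by simp, by simp, by simp, by omega⟩
        · have p1 : (s + 1 + (u + 1)).choose (u + 1) =
              (s + 1 + u).choose u + (s + (u + 1)).choose (u + 1) := by
            rw [show s + 1 + (u + 1) = s + 1 + u + 1 by ring, Nat.choose_succ_succ,
              show s + (u + 1) = s + 1 + u by ring]
          have p2 : (s + 1 + (u + 1) + 1).choose (u + 1 + 1) =
              (s + 1 + u + 1).choose (u + 1) + (s + (u + 1) + 1).choose (u + 1 + 1) := by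
            rw [show s + 1 + (u + 1) + 1 = s + 1 + u + 1 + 1 by ring, Nat.choose_succ_succ,
              show s + (u + 1) + 1 = s + 1 + u + 1 by ring]
          have p3 : (s + 1 + (u + 1) + 1).choose (u + 1) =
              (s + 1 + u + 1).choose u + (s + (u + 1) + 1).choose (u + 1) := by
            rw [show s + 1 + (u + 1) + 1 = s + 1 + u + 1 + 1 by ring, Nat.choose_succ_succ,
              show s + (u + 1) + 1 = s + 1 + u + 1 by ring]
          have q1 : 1 ≤ (s + 1 + u).choose u := Nat.choose_pos (by omega)
          have q2 : 1 ≤ (s + (u + 1)).choose (u + 1) := Nat.choose_pos (by omega)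
          have q3 : (s + 1 + u).choose u ≤ (s + 1 + u + 1).choose (u + 1) := by
            rw [Nat.choose_succ_succ]; omega
          have q4 : (s + (u + 1)).choose (u + 1) ≤ (s + (u + 1) + 1).choose (u + 1 + 1) := by
            rw [Nat.choose_succ_succ]; omega
          obtain ⟨k, hk⟩ : ∃ k, k = max ((s + 1 + u).choose u)
            (n - (s + (u + 1) + 1).choose (u + 1 + 1)) := ⟨_, rfl⟩
          have hkn : k < n := by omega
          -- The lower ends of the two ranges ensure that `A₁` and `A₂` are not truncated.
          have r1 : (s + (u + 1) + 1).choose (u + 1) ≤ (u + 1 + 1) * (n - k) :=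
            (choose_succ_le_mul_choose s (u + 1)).trans (Nat.mul_le_mul_left _ (by omega))
          have r2 : (s + 1 + u + 1).choose u ≤ (u + 1) * k :=
            (choose_succ_le_mul_choose (s + 1) u).trans (Nat.mul_le_mul_left _ (by omega))
          refine ⟨k, u, (u + 1 + 1) * (n - k) - (s + (u + 1) + 1).choose (u + 1),
            (u + 1) * k - (s + 1 + u + 1).choose u, by omega, hkn, by omega, by omega,
            by omega, by omega, by omega, by omega, ?_⟩
          have e : (u + 1 + 1) * n = (u + 1 + 1) * (n - k) + (u + 1) * k + k := by
            obtain ⟨l, rfl⟩ : ∃ l, n = l + k := ⟨n - k, by omega⟩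
            rw [Nat.add_sub_cancel]; ring
          omega
      have hdC : d ∉ C := fun hd => lt_irrefl d (hC d hd)
      -- The remaining `k - 1` steps after `u_d`.
      have e1 : max (max f (d + n - 1)) (d + k - 1) = max f (d + n - 1) := by omega
      obtain ⟨τ₂, h2, c2⟩ := ih k hkn (s + 1) v d A₂ C (max f (d + n - 1)) σ hlo2 hhi2 hA2 hC
        hcard (by omega) (by omega) (by rw [e1]; exact h)
      rw [e1] at c2
      -- The steps beyond `d + k`, after which the step that leads to `u_{d + k}` is reversed.
      have e2 : max (max f (d + k)) (d + k + (n - k) - 1) = max f (d + n - 1) := by omega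
      have e3 : d + k + (n - k) - 1 = d + n - 1 := by omega
      have herase : (insert d C).erase d = C := Finset.erase_insert hdC
      obtain ⟨τ₁, h1, c1⟩ := ih (n - k) (by omega) s u (d + k) A₁ (insert d C) (max f (d + k))
        (.reverse :: .restore d :: .discard d :: τ₂) hlo1 hhi1 hA1
        (by
          intro i hi
          rcases Finset.mem_insert.1 hi with rfl | hi
          · omega
          · have := hC i hi
            omega)
        (by rw [Finset.card_insert_of_notMem hdC]; omega) (by omega) (by omega)
        (by
          refine ⟨⟨rfl, rfl⟩, Finset.mem_insert_self d C, Finset.mem_insert_self d C, ?_⟩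
          simp only [State.next, herase, e2]
          exact h2)
      rw [e2, e3] at c1
      rw [e3] at h1
      obtain ⟨τ₀, h0, c0⟩ := exists_schedule_advance k d true (insert d C) (d + n - 1) f τ₁ hk1
        (by omega) hf h1
      refine ⟨.store :: τ₀, ⟨⟨rfl, ?_⟩, h0⟩, ?_⟩
      · rw [Finset.card_insert_of_notMem hdC]
        omega
      · simp only [recomputationsFrom, State.cost, State.next, herase, Nat.zero_add] at c1 ⊢
        omega

theorem exists_isSchedule {m s u A : ℕ} (hm : 1 ≤ m)
    (hlo : (s + u).choose u ≤ m) (hhi : m ≤ (s + u + 1).choose (u + 1))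
    (hA : A + (s + u + 1).choose u = (u + 1) * m) :
    ∃ σ, IsSchedule m s σ ∧ recomputations m σ + m = A + 1 := by
  obtain ⟨τ, h, c⟩ := exists_schedule_segment (m := m) (c := s) m s u 1 A ∅ 1 [.reverse] hlo hhi hA
    (by simp) (by simp) (by omega) le_rfl ⟨⟨rfl, rfl⟩, rfl⟩
  rw [Nat.add_sub_cancel_left] at h c
  refine ⟨.advance :: τ, ⟨hm, h⟩, ?_⟩
  simp only [recomputations, recomputationsFrom, State.cost, State.next, State.initial,
    lt_irrefl, if_false, Nat.zero_add, max_eq_right hm] at c ⊢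
  simp only [Nat.zero_max]
  omega

/-! ### The repetition number -/

theorem binom_natCast (n k : ℕ) : binom n k = n.choose k := by
  simp [binom, Ring.choose_natCast]

theorem binom_add_natCast (s u : ℕ) : binom ((s : ℤ) + u) u = ((s + u).choose u : ℕ) := by
  rw [← Nat.cast_add, binom_natCast]

theorem binom_of_neg {t : ℤ} (ht : t < 0) (n : ℤ) : binom n t = 0 :=
  if_neg (by omega)

theorem choose_add_mono (s : ℕ) : Monotone fun u : ℕ => (s + u).choose u := by
  refine monotone_nat_of_le_succ fun u => ?_
  change (s + u).choose u ≤ (s + u + 1).choose (u + 1)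
  rw [Nat.choose_succ_succ]
  exact Nat.le_add_right _ _

theorem binom_add_mono (s : ℕ) : Monotone fun t : ℤ => binom ((s : ℤ) + t) t := by
  intro t t' h
  change binom ((s : ℤ) + t) t ≤ binom ((s : ℤ) + t') t'
  rcases lt_or_ge t' 0 with h' | h'
  · rw [binom_of_neg h', binom_of_neg (h.trans_lt h')]
  lift t' to ℕ using h'
  rcases lt_or_ge t 0 with ht | ht
  · rw [binom_of_neg ht, binom_add_natCast]
    positivity
  lift t to ℕ using ht
  rw [binom_add_natCast, binom_add_natCast]
  exact_mod_cast choose_add_mono s (by exact_mod_cast h)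

theorem existsUnique_isRepetitionNumber {m s : ℕ} (hm : 1 ≤ m) (hs : 1 ≤ s) :
    ∃! t : ℤ, IsRepetitionNumber m s t := by
  refine existsUnique_of_exists_of_unique ?_ ?_
  · have hex : ∃ u : ℕ, m ≤ (s + u).choose u := by
      refine ⟨m, ?_⟩
      have h : (m + 1).choose m ≤ (s + m).choose m := Nat.choose_le_choose m (by omega)
      rw [Nat.choose_succ_self_right] at h
      omega
    classical
    refine ⟨(Nat.find hex : ℕ), ?_, ?_⟩
    · rcases hu : Nat.find hex with _ | u
      · rw [binom_of_neg (by simp)]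
        omega
      · have h : ¬ m ≤ (s + u).choose u := Nat.find_min hex (by omega)
        rw [show ((s : ℤ) + (u + 1 : ℕ) - 1) = s + u by push_cast; ring,
          show (((u + 1 : ℕ) : ℤ) - 1) = u by push_cast; ring, binom_add_natCast]
        omega
    · rw [binom_add_natCast]
      exact_mod_cast Nat.find_spec hex
  · have key : ∀ t t' : ℤ, IsRepetitionNumber m s t → IsRepetitionNumber m s t' → t' ≤ t := by
      intro t t' h h'
      by_contra! hlt
      have h1 := binom_add_mono s (show t ≤ t' - 1 by omega)
      have h2 := h.2
      have h3 := h'.1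
      simp only [← add_sub_assoc] at h1
      omega
    exact fun t t' h h' => le_antisymm (key t' t h' h) (key t t' h h')

theorem IsRepetitionNumber.cases {m s : ℕ} {t : ℤ} (hm : 1 ≤ m)
    (h : IsRepetitionNumber m s t) :
    t = 0 ∧ m = 1 ∨ ∃ u : ℕ, t = (u + 1 : ℕ) ∧ (s + u).choose u < m ∧
      m ≤ (s + u + 1).choose (u + 1) := by
  obtain ⟨h1, h2⟩ := h
  have ht : 0 ≤ t := by
    by_contra! ht
    rw [binom_of_neg ht] at h2
    omega
  lift t to ℕ using ht
  rw [binom_add_natCast] at h2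
  rcases t with _ | u
  · simp at h2
    exact Or.inl ⟨rfl, by omega⟩
  · rw [show ((s : ℤ) + (u + 1 : ℕ) - 1) = s + u by push_cast; ring,
      show (((u + 1 : ℕ) : ℤ) - 1) = u by push_cast; ring, binom_add_natCast] at h1
    exact Or.inr ⟨u, rfl, by exact_mod_cast h1, by exact_mod_cast h2⟩

end Checkpointing

theorem mainTheorem1 (m s : ℕ) (hm : 1 ≤ m) (hs : 1 ≤ s) :
    (∃! t : ℤ, Checkpointing.IsRepetitionNumber m s t) ∧
      ∀ t : ℤ, Checkpointing.IsRepetitionNumber m s t →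
        IsLeast
          {r : ℤ | ∃ σ : List Checkpointing.Action,
            Checkpointing.IsSchedule m s σ ∧ (Checkpointing.recomputations m σ : ℤ) = r}
          ((t - 1) * m - Checkpointing.binom (s + t) (t - 1) + 1) := by
  open Checkpointing in
  refine ⟨existsUnique_isRepetitionNumber hm hs, fun t ht => ?_⟩
  rcases ht.cases hm with ⟨rfl, rfl⟩ | ⟨u, rfl, hlo, hhi⟩
  · rw [binom_of_neg (by norm_num)]
    refine ⟨?_, ?_⟩
    · obtain ⟨σ, h, hc⟩ := exists_isSchedule (m := 1) (s := s) (u := 0) (A := 0) le_rfl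
        (by simp) (by simp) (by simp)
      exact ⟨σ, h, by push_cast; omega⟩
    · rintro r ⟨σ, -, rfl⟩
      push_cast
      omega
  · have hb : binom ((s : ℤ) + (u + 1 : ℕ)) ((u + 1 : ℕ) - 1) = ((s + u + 1).choose u : ℕ) := by
      rw [show (((u + 1 : ℕ) : ℤ) - 1) = u by push_cast; ring, ← Nat.cast_add, binom_natCast]
      rfl
    have hv : (((u + 1 : ℕ) : ℤ) - 1) * m = (u + 1) * m - m := by push_cast; ring
    rw [hb, hv]
    have hle : (s + u + 1).choose u ≤ (u + 1) * m :=
      (choose_succ_le_mul_choose s u).trans (Nat.mul_le_mul_left _ hlo.le)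
    have h3 : (((u + 1) * m : ℕ) : ℤ) = (u + 1) * m := by push_cast; ring
    refine ⟨?_, ?_⟩
    · obtain ⟨σ, h, hc⟩ := exists_isSchedule (A := (u + 1) * m - (s + u + 1).choose u) hm hlo.le hhi
        (Nat.sub_add_cancel hle)
      exact ⟨σ, h, by omega⟩
    · rintro r ⟨σ, h, rfl⟩
      have h1 := stepBound_le_recomputations hm h (u + 1)
      have h2 := le_stepBound (le_refl (u + 1)) m s
      simp only [Nat.add_sub_cancel, ← Nat.add_assoc] at h2
      omega
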